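/- **Ultragraphs.** An ultragraph $\mathcal G=(G^0,\mathcal G^1,r,s)$ consists of countable sets $G^0,\mathcal G^1$, a map $s:\mathcal G^1\to G^0$ and a map $r:\mathcal G^1\to P(G^0)\setminus\{\emptyset\}$. Let $\mathcal G^0$ be the smallest subset of $P(G^0)$ that contains $\{v\}$ for all $v\in G^0$ and $r(e)$ for all $e\in\mathcal G^1$ and is closed under finite unions (including the empty union $\emptyset$) and intersections of nonempty finite families. The ultragraph algebra $C^*(\mathcal G)$ is the universal C*-algebra generated by partial isometries $\{s_e\}_{e\in\mathcal G^1}$ with orthogonal ranges and projections $\{p_A\}_{A\in\mathcal G^0}$ satisfying: (1) $p_\emptyset=0$, $p_Ap_B=p_{A\cap B}$, $p_{A\cup B}=p_A+p_B-p_{A\cap B}$ for all $A,B\in\mathcal G^0$; (2) $s_e^*s_e=p_{r(e)}$ for all $e$; (3) $s_es_e^*\le p_{s(e)}$ for all $e$; (4) $p_v=\sum_{s(e)=v}s_es_e^*$ whenever $0<|s^{-1}(v)|<\infty$. Here $p_v=p_{\{v\}}$. **Branching systems.** Let $(X,\mu)$ be a $\sigma$-finite measure space. A $\mathcal G$-branching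 system on $(X,\mu)$ consists of measurable sets $R_e, D_A\subseteq X$ ($e\in\mathcal G^1$, $A\in\mathcal G^0$) and measurable maps $f_e:D_{r(e)}\to R_e$, $f_e^{-1}:R_e\to D_{r(e)}$ such that, with $D_v=D_{\{v\}}$ and up to $\mu$-null sets where equality or inclusion of sets is marked a.e., 1. $R_e\cap R_{e'}=\emptyset$ a.e. if $e\ne e'$; 2. $D_\emptyset=\emptyset$, and $D_A\cap D_B=D_{A\cap B}$ a.e., $D_A\cup D_B=D_{A\cup B}$ a.e. for all $A,B\in\mathcal G^0$; 3. $R_e\subseteq D_{s(e)}$ a.e. for all $e$; 4. $D_v=\bigcup_{e\in s^{-1}(v)}R_e$ a.e. if $0<|s^{-1}(v)|<\infty$; 5. for each $e$, $f_e\circ f_e^{-1}=\mathrm{id}_{R_e}$ and $f_e^{-1}\circ f_e=\mathrm{id}_{D_{r(e)}}$ $\mu$-a.e.; the push-forward $\mu\circ f_e$ of $\mu|_{R_e}$ under $f_e^{-1}$ is absolutely continuous with respect to $\mu$ on $D_{r(e)}$; and the push-forward $\mu\circ f_e^{-1}$ of $\mu|_{D_{r(e)}}$ under $f_e$ is absolutely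 continuous with respect to $\mu$ on $R_e$. Let $\Phi_{f_e^{-1}}=d(\mu\circ f_e^{-1})/d\mu$ be the Radon–Nikodym derivative on $R_e$. For $\phi\in L^2(X,\mu)$, the function $\Phi_{f_e^{-1}}^{1/2}\cdot(\phi\circ f_e^{-1})$ on $R_e$ is extended by zero to $X$. **Theorem.** Let $\mathcal G$ be an ultragraph and let $\{R_e,D_A,f_e\}_{e\in\mathcal G^1,A\in\mathcal G^0}$ be a $\mathcal G$-branching system on a $\sigma$-finite measure space $(X,\mu)$. Then there exists a unique representation (that is, a $*$-homomorphism, not required to be nondegenerate) $\pi:C^*(\mathcal G)\to B(L^2(X,\mu))$ such that $$\pi(s_e)(\phi)=\Phi_{f_e^{-1}}^{1/2}\cdot(\phi\circ f_e^{-1})\qquad\text{and}\qquad \pi(p_A)(\phi)=\chi_{D_A}\phi$$ for all $e\in\mathcal G^1$, $A\in\mathcal G^0$ and $\phi\in L^2(X,\mu)$. -/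

import Mathlib

open MeasureTheory
open scoped ENNReal

/-! ### Ultragraphs -/

/-- An ultragraph: countable sets of vertices and edges, a source map, and a range map with values
in the nonempty sets of vertices. -/
structure Ultragraph (V E : Type*) where
  /-- the vertex set is countable -/
  countable_vertex : Countable V
  /-- the edge set is countable -/
  countable_edge : Countable E
  /-- the source map -/
  source : E → V
  /-- the range map -/
  range : E → Set V
  /-- ranges are nonempty -/
  range_nonempty : ∀ e, (range e).Nonempty

namespace Ultragraph

variable {V E : Type*}

/-- Membership in `𝒢⁰`, the smallest family of sets of vertices which contains all singletons and
all ranges of edges and is closed under finite unions (including the empty union `∅`) and under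
intersections of nonempty finite families. -/
inductive IsGenVertex (G : Ultragraph V E) : Set V → Prop
  | empty : G.IsGenVertex ∅
  | singleton (v : V) : G.IsGenVertex {v}
  | range (e : E) : G.IsGenVertex (G.range e)
  | union {A B : Set V} : G.IsGenVertex A → G.IsGenVertex B → G.IsGenVertex (A ∪ B)
  | inter {A B : Set V} : G.IsGenVertex A → G.IsGenVertex B → G.IsGenVertex (A ∩ B)

/-- The set `𝒢⁰` of generalized vertices, as a type. -/
def GenVertex (G : Ultragraph V E) : Type _ := {A : Set V // G.IsGenVertex A}

namespace GenVertex

variable {G : Ultragraph V E}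

/-- The empty set in `𝒢⁰`. -/
def empty : G.GenVertex := ⟨∅, .empty⟩

/-- The singleton `{v}` in `𝒢⁰`. -/
def vertex (v : V) : G.GenVertex := ⟨{v}, .singleton v⟩

/-- The range `r(e)` in `𝒢⁰`. -/
def rangeOf (e : E) : G.GenVertex := ⟨G.range e, .range e⟩

/-- The union of two members of `𝒢⁰`. -/
def union (A B : G.GenVertex) : G.GenVertex := ⟨A.1 ∪ B.1, .union A.2 B.2⟩

/-- The intersection of two members of `𝒢⁰`. -/
def inter (A B : G.GenVertex) : G.GenVertex := ⟨A.1 ∩ B.1, .inter A.2 B.2⟩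

end GenVertex

end Ultragraph

/-! ### The free unital `*`-algebra -/

/-- Words in letters `x` (the pairs `(x, false)`) and `x*` (the pairs `(x, true)`). -/
abbrev StarWord (X : Type*) := FreeMonoid (X × Bool)

namespace StarWord

variable {X : Type*}

/-- The adjoint of a word: reverse it and replace each letter by its adjoint. -/
def adj (w : StarWord X) : StarWord X :=
  FreeMonoid.map (fun y : X × Bool => (y.1, !y.2)) (star w)

theorem adj_mul (v w : StarWord X) : adj (v * w) = adj w * adj v := by
  simp [adj]

theorem adj_adj (w : StarWord X) : adj (adj w) = w := by
  induction w using FreeMonoid.inductionOn' with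
  | one => simp [adj]
  | of_mul x w ih =>
    rw [adj_mul, adj_mul, ih]
    simp [adj]

/-- The adjoint of words as a bijection. -/
def adjEquiv (X : Type*) : StarWord X ≃ StarWord X := ⟨adj, adj, adj_adj, adj_adj⟩

end StarWord

/-- The free unital `*`-algebra over `ℂ` on a set `X` of generators: the `*`-polynomials in
noncommuting variables `x ∈ X`. -/
def FreeStarAlgebra (X : Type*) : Type _ := MonoidAlgebra ℂ (StarWord X)

namespace FreeStarAlgebra

variable {X : Type*}

noncomputable instance : Ring (FreeStarAlgebra X) :=
  inferInstanceAs (Ring (MonoidAlgebra ℂ (StarWord X)))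

noncomputable instance : Algebra ℂ (FreeStarAlgebra X) :=
  inferInstanceAs (Algebra ℂ (MonoidAlgebra ℂ (StarWord X)))

/-- The monomial `c • w`. -/
noncomputable def mono (w : StarWord X) (c : ℂ) : FreeStarAlgebra X := MonoidAlgebra.single w c

/-- The generator `x`. -/
noncomputable def gen (x : X) : FreeStarAlgebra X := mono (FreeMonoid.of (x, false)) 1

theorem mono_add (w : StarWord X) (c d : ℂ) :
    mono w (c + d) = mono w c + mono w d := MonoidAlgebra.single_add w c d

theorem mono_mul_mono (v w : StarWord X) (c d : ℂ) :
    mono v c * mono w d = mono (v * w) (c * d) := MonoidAlgebra.single_mul_single v w c d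

theorem smul_mono (a : ℂ) (w : StarWord X) (c : ℂ) : a • mono w c = mono w (a * c) :=
  MonoidAlgebra.smul_single' a w c

theorem induction_add {motive : FreeStarAlgebra X → Prop} (x : FreeStarAlgebra X)
    (zero : motive 0) (add : ∀ a b, motive a → motive b → motive (a + b))
    (mono : ∀ w c, motive (mono w c)) : motive x :=
  MonoidAlgebra.induction_linear (motive := motive) x zero (fun a b => add a b) mono

/-- The additive map `∑ c_w w ↦ ∑ (conj c_w) w*`. -/
noncomputable def adjHom (X : Type*) : FreeStarAlgebra X →+ FreeStarAlgebra X where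
  toFun f := MonoidAlgebra.ofCoeff
    (Finsupp.mapRange (star : ℂ → ℂ) (star_zero ℂ)
      (Finsupp.equivMapDomain (StarWord.adjEquiv X) (MonoidAlgebra.coeff f)))
  map_zero' := by
    apply MonoidAlgebra.coeff_injective
    ext w
    exact star_zero ℂ
  map_add' f g := by
    apply MonoidAlgebra.coeff_injective
    ext w
    exact star_add (R := ℂ) _ _

theorem adjHom_mono (w : StarWord X) (c : ℂ) :
    adjHom X (mono w c) = mono (StarWord.adj w) (star c) := by
  apply MonoidAlgebra.coeff_injective
  change Finsupp.mapRange (star : ℂ → ℂ) (star_zero ℂ)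
    (Finsupp.equivMapDomain (StarWord.adjEquiv X) (Finsupp.single w c)) = Finsupp.single _ _
  rw [Finsupp.equivMapDomain_single, Finsupp.mapRange_single]
  rfl

noncomputable instance : StarRing (FreeStarAlgebra X) where
  star := adjHom X
  star_involutive a := by
    induction a using induction_add with
    | zero => simp
    | add a b ha hb => simp [ha, hb]
    | mono w c => simp [adjHom_mono, StarWord.adj_adj]
  star_mul a b := by
    change adjHom X (a * b) = adjHom X b * adjHom X a
    induction a using induction_add with
    | zero => simp
    | add a₁ a₂ h₁ h₂ => rw [add_mul, map_add, map_add, mul_add, h₁, h₂]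
    | mono v c =>
      induction b using induction_add with
      | zero => simp
      | add b₁ b₂ h₁ h₂ => rw [mul_add, map_add, map_add, add_mul, h₁, h₂]
      | mono w d =>
        rw [mono_mul_mono, adjHom_mono, adjHom_mono, adjHom_mono, mono_mul_mono,
          StarWord.adj_mul, star_mul]
  star_add a b := map_add (adjHom X) a b

theorem star_mono (w : StarWord X) (c : ℂ) :
    star (mono w c) = mono (StarWord.adj w) (star c) := adjHom_mono w c

noncomputable instance : StarModule ℂ (FreeStarAlgebra X) where
  star_smul c a := by
    induction a using induction_add with
    | zero => simp
    | add a b ha hb => rw [smul_add, star_add, star_add, smul_add, ha, hb]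
    | mono w d => rw [smul_mono, star_mono, star_mono, smul_mono, star_mul, mul_comm]

theorem mono_one_one : mono (1 : StarWord X) 1 = 1 := rfl

theorem mono_of_mul (y : X × Bool) (w : StarWord X) (c : ℂ) :
    mono (FreeMonoid.of y * w) c
      = (if y.2 then star (gen y.1) else gen y.1) * mono w c := by
  rcases y with ⟨x, b⟩
  cases b
  · simp [gen, mono_mul_mono]
  · simp [gen, star_mono, mono_mul_mono, StarWord.adj]

end FreeStarAlgebra

/-! ### The C*-algebra of an ultragraph -/

namespace Ultragraph

variable {V E : Type*} (G : Ultragraph V E)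

/-- `*`-polynomials in the symbols `s_e` (`e` an edge) and `p_A` (`A ∈ 𝒢⁰`). -/
abbrev Poly := FreeStarAlgebra (E ⊕ G.GenVertex)

/-- The symbol `s_e`. -/
noncomputable def polyS (e : E) : G.Poly := FreeStarAlgebra.gen (Sum.inl e)

/-- The symbol `p_A`. -/
noncomputable def polyP (A : G.GenVertex) : G.Poly := FreeStarAlgebra.gen (Sum.inr A)

/-- The defining relations of `C*(𝒢)`; `CKRel a b` is the relation `a = b`. For projections `q` and
`p`, the inequality `q ≤ p` is the relation `p q = q`. -/
inductive CKRel : G.Poly → G.Poly → Prop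
  /-- `s_e` is a partial isometry -/
  | partial_isometry (e : E) : CKRel (G.polyS e * star (G.polyS e) * G.polyS e) (G.polyS e)
  /-- different `s_e` have orthogonal ranges -/
  | orthogonal (e f : E) : e ≠ f → CKRel (star (G.polyS e) * G.polyS f) 0
  /-- `p_A` is self-adjoint -/
  | selfAdjoint (A : G.GenVertex) : CKRel (star (G.polyP A)) (G.polyP A)
  /-- `p_A` is idempotent -/
  | idempotent (A : G.GenVertex) : CKRel (G.polyP A * G.polyP A) (G.polyP A)
  /-- `p_∅ = 0` -/
  | empty : CKRel (G.polyP .empty) 0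
  /-- `p_A p_B = p_{A ∩ B}` -/
  | inter (A B : G.GenVertex) : CKRel (G.polyP A * G.polyP B) (G.polyP (A.inter B))
  /-- `p_{A ∪ B} = p_A + p_B - p_{A ∩ B}` -/
  | union (A B : G.GenVertex) :
      CKRel (G.polyP (A.union B)) (G.polyP A + G.polyP B - G.polyP (A.inter B))
  /-- `s_e* s_e = p_{r(e)}` -/
  | range (e : E) : CKRel (star (G.polyS e) * G.polyS e) (G.polyP (.rangeOf e))
  /-- `s_e s_e* ≤ p_{s(e)}` -/
  | source (e : E) :
      CKRel (G.polyP (.vertex (G.source e)) * (G.polyS e * star (G.polyS e)))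
        (G.polyS e * star (G.polyS e))
  /-- `p_v = ∑_{s(e) = v} s_e s_e*` if `0 < |s⁻¹(v)| < ∞` -/
  | vertex (v : V) (T : Finset E) : T.Nonempty → (∀ e, e ∈ T ↔ G.source e = v) →
      CKRel (G.polyP (.vertex v)) (∑ e ∈ T, G.polyS e * star (G.polyS e))

/-- The C*-seminorms on the `*`-polynomials in which the defining relations hold: these are exactly
the functions `a ↦ ‖ρ a‖` for `ρ` a unital `*`-homomorphism to a unital C*-algebra which maps the
symbols `s_e`, `p_A` to a Cuntz-Krieger family. -/
structure IsCKSeminorm (p : Seminorm ℂ G.Poly) : Prop where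
  mul_le : ∀ a b, p (a * b) ≤ p a * p b
  star_mul_self : ∀ a, p (star a * a) = p a ^ 2
  rel : ∀ a b, G.CKRel a b → p (a - b) = 0

variable {G}

namespace IsCKSeminorm

variable {p : Seminorm ℂ G.Poly}

theorem eq_of_rel (hp : G.IsCKSeminorm p) {a b : G.Poly} (h : G.CKRel a b) : p a = p b := by
  have h0 := hp.rel a b h
  have h1 := abs_sub_map_le_sub p a b
  rw [h0] at h1
  exact sub_eq_zero.1 (abs_nonpos_iff.1 h1)

theorem star_le (hp : G.IsCKSeminorm p) (a : G.Poly) : p (star a) ≤ p a := by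
  have h1 := hp.star_mul_self (star a)
  have h2 := hp.mul_le (star (star a)) (star a)
  rw [h1, star_star, sq] at h2
  rcases (apply_nonneg p (star a)).eq_or_lt with h | h
  · rw [← h]
    exact apply_nonneg p a
  · exact le_of_mul_le_mul_right h2 h

theorem star_eq (hp : G.IsCKSeminorm p) (a : G.Poly) : p (star a) = p a :=
  le_antisymm (hp.star_le a) (by simpa using hp.star_le (star a))

theorem polyP_le (hp : G.IsCKSeminorm p) (A : G.GenVertex) : p (G.polyP A) ≤ 1 := by
  have h1 : p (star (G.polyP A) * G.polyP A) ≤ p (G.polyP A) := by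
    have h2 : star (G.polyP A) * G.polyP A
        = (star (G.polyP A) - G.polyP A) * G.polyP A + G.polyP A * G.polyP A := by
      rw [sub_mul, sub_add_cancel]
    rw [h2]
    refine (map_add_le_add p _ _).trans ?_
    rw [hp.eq_of_rel (.idempotent A)]
    have h3 := hp.mul_le (star (G.polyP A) - G.polyP A) (G.polyP A)
    rw [hp.rel _ _ (.selfAdjoint A), zero_mul] at h3
    linarith
  rw [hp.star_mul_self] at h1
  nlinarith [apply_nonneg p (G.polyP A)]

theorem polyS_le (hp : G.IsCKSeminorm p) (e : E) : p (G.polyS e) ≤ 1 := by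
  have h1 := hp.star_mul_self (G.polyS e)
  rw [hp.eq_of_rel (.range e)] at h1
  have h2 := hp.polyP_le (.rangeOf e)
  nlinarith [apply_nonneg p (G.polyS e)]

theorem one_le (hp : G.IsCKSeminorm p) : p 1 ≤ 1 := by
  have h1 := hp.star_mul_self 1
  rw [star_one, one_mul] at h1
  nlinarith [apply_nonneg p (1 : G.Poly)]

theorem mono_le (hp : G.IsCKSeminorm p) (w : StarWord (E ⊕ G.GenVertex)) (c : ℂ) :
    p (FreeStarAlgebra.mono w c) ≤ ‖c‖ := by
  induction w using FreeMonoid.inductionOn' with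
  | one =>
    have h : (FreeStarAlgebra.mono 1 c : G.Poly) = c • 1 := by
      rw [← FreeStarAlgebra.mono_one_one, FreeStarAlgebra.smul_mono, mul_one]
    rw [h, map_smul_eq_mul]
    exact mul_le_of_le_one_right (norm_nonneg c) hp.one_le
  | of_mul y w ih =>
    rw [FreeStarAlgebra.mono_of_mul]
    refine (hp.mul_le _ _).trans ?_
    have h1 : p (FreeStarAlgebra.gen y.1) ≤ 1 := by
      rcases y with ⟨e | A, b⟩
      · exact hp.polyS_le e
      · exact hp.polyP_le A
    have h2 : p (if y.2 then star (FreeStarAlgebra.gen y.1) else FreeStarAlgebra.gen y.1) ≤ 1 := by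
      split_ifs
      · rw [hp.star_eq]
        exact h1
      · exact h1
    exact (mul_le_of_le_one_left (apply_nonneg p _) h2).trans ih

end IsCKSeminorm

variable (G)

theorem bddAbove_seminorm (a : G.Poly) :
    BddAbove (Set.range fun p : {p : Seminorm ℂ G.Poly // G.IsCKSeminorm p} => p.1 a) := by
  induction a using FreeStarAlgebra.induction_add with
  | zero => exact ⟨0, by rintro _ ⟨p, rfl⟩; simp⟩
  | add a b ha hb =>
    obtain ⟨C, hC⟩ := ha
    obtain ⟨D, hD⟩ := hb
    refine ⟨C + D, ?_⟩
    rintro _ ⟨p, rfl⟩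
    exact (map_add_le_add p.1 a b).trans (add_le_add (hC ⟨p, rfl⟩) (hD ⟨p, rfl⟩))
  | mono w c => exact ⟨‖c‖, by rintro _ ⟨p, rfl⟩; exact p.2.mono_le w c⟩

instance : Nonempty {p : Seminorm ℂ G.Poly // G.IsCKSeminorm p} :=
  ⟨⟨0, ⟨fun _ _ => by simp, fun _ => by simp, fun _ _ _ => by simp⟩⟩⟩

/-- The universal C*-seminorm `‖a‖ = sup_p p(a)`. -/
noncomputable def univNorm (a : G.Poly) : ℝ :=
  ⨆ p : {p : Seminorm ℂ G.Poly // G.IsCKSeminorm p}, p.1 a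

variable {G}

theorem le_univNorm {p : Seminorm ℂ G.Poly} (hp : G.IsCKSeminorm p) (a : G.Poly) :
    p a ≤ G.univNorm a :=
  le_ciSup (G.bddAbove_seminorm a) ⟨p, hp⟩

theorem univNorm_le {a : G.Poly} {C : ℝ} (h : ∀ p, G.IsCKSeminorm p → p a ≤ C) :
    G.univNorm a ≤ C :=
  ciSup_le fun p => h p.1 p.2

theorem univNorm_nonneg (a : G.Poly) : 0 ≤ G.univNorm a :=
  Real.iSup_nonneg fun p => apply_nonneg p.1 a

variable (G)

/-- The universal C*-seminorm is a C*-seminorm in which the defining relations hold. -/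
noncomputable def univSeminorm : Seminorm ℂ G.Poly :=
  Seminorm.ofSMulLE G.univNorm
    (le_antisymm (univNorm_le fun p _ => by simp) (univNorm_nonneg 0))
    (fun a b => univNorm_le fun p hp =>
      (map_add_le_add p a b).trans (add_le_add (le_univNorm hp a) (le_univNorm hp b)))
    (fun c a => univNorm_le fun p hp => by
      rw [map_smul_eq_mul]
      exact mul_le_mul_of_nonneg_left (le_univNorm hp a) (norm_nonneg c))

theorem univSeminorm_isCKSeminorm : G.IsCKSeminorm G.univSeminorm where
  mul_le a b := univNorm_le fun p hp => (hp.mul_le a b).trans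
    (mul_le_mul (le_univNorm hp a) (le_univNorm hp b) (apply_nonneg p b) (univNorm_nonneg a))
  star_mul_self a := by
    refine le_antisymm (univNorm_le fun p hp => ?_) ?_
    · rw [hp.star_mul_self]
      exact pow_le_pow_left₀ (apply_nonneg p a) (le_univNorm hp a) 2
    · have h : G.univNorm a ≤ Real.sqrt (G.univNorm (star a * a)) := univNorm_le fun p hp => by
        apply Real.le_sqrt_of_sq_le
        rw [← hp.star_mul_self]
        exact le_univNorm hp _
      calc G.univNorm a ^ 2 ≤ Real.sqrt (G.univNorm (star a * a)) ^ 2 :=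
            pow_le_pow_left₀ (univNorm_nonneg a) h 2
        _ = G.univNorm (star a * a) := Real.sq_sqrt (univNorm_nonneg _)
  rel a b h := le_antisymm (univNorm_le fun p hp => (hp.rel a b h).le) (univNorm_nonneg _)

/-- The `*`-polynomials are equipped with the universal C*-seminorm. -/
noncomputable instance : SeminormedAddCommGroup G.Poly :=
  AddGroupSeminorm.toSeminormedAddCommGroup (E := G.Poly) G.univSeminorm.toAddGroupSeminorm

noncomputable instance : SeminormedRing G.Poly where
  __ := (inferInstance : SeminormedAddCommGroup G.Poly)
  __ := (inferInstance : Ring G.Poly)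
  norm_mul_le := G.univSeminorm_isCKSeminorm.mul_le

noncomputable instance : NormedAlgebra ℂ G.Poly where
  __ := (inferInstance : Algebra ℂ G.Poly)
  norm_smul_le c a := (map_smul_eq_mul G.univSeminorm c a).le

theorem norm_poly (a : G.Poly) : ‖a‖ = G.univNorm a := rfl

noncomputable instance : NormedStarGroup G.Poly where
  norm_star_le a := G.univSeminorm_isCKSeminorm.star_le a

/-- The universal unital C*-algebra generated by a Cuntz-Krieger family: the Hausdorff completion of
the `*`-polynomials in the universal C*-seminorm. -/
def UnivCStar : Type _ := UniformSpace.Completion G.Poly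

namespace UnivCStar

noncomputable instance : NormedRing G.UnivCStar :=
  inferInstanceAs (NormedRing (UniformSpace.Completion G.Poly))

instance : CompleteSpace G.UnivCStar :=
  inferInstanceAs (CompleteSpace (UniformSpace.Completion G.Poly))

noncomputable instance : Algebra ℂ G.UnivCStar :=
  inferInstanceAs (Algebra ℂ (UniformSpace.Completion G.Poly))

noncomputable instance : NormedAlgebra ℂ G.UnivCStar where
  norm_smul_le := norm_smul_le (α := ℂ) (β := UniformSpace.Completion G.Poly)

/-- The class of a `*`-polynomial. -/
noncomputable def mk : G.Poly →ₐ[ℂ] G.UnivCStar where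
  __ := (UniformSpace.Completion.coeRingHom : G.Poly →+* UniformSpace.Completion G.Poly)
  commutes' _ := rfl

theorem norm_mk (a : G.Poly) : ‖mk G a‖ = ‖a‖ := UniformSpace.Completion.norm_coe a

theorem continuous_mk : Continuous (mk G) :=
  UniformSpace.Completion.continuous_coe G.Poly

theorem denseRange_mk : DenseRange (mk G) := UniformSpace.Completion.denseRange_coe

/-- The adjoint on the completion: the continuous extension of the adjoint of `*`-polynomials. -/
noncomputable def adj : G.UnivCStar → G.UnivCStar :=
  UniformSpace.Completion.map (star : G.Poly → G.Poly)

theorem uniformContinuous_star : UniformContinuous (star : G.Poly → G.Poly) :=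
  star_isometry.uniformContinuous

theorem adj_mk (a : G.Poly) : adj G (mk G a) = mk G (star a) :=
  UniformSpace.Completion.map_coe (uniformContinuous_star G) a

theorem continuous_adj : Continuous (adj G) := UniformSpace.Completion.continuous_map

noncomputable instance : StarRing G.UnivCStar where
  star := adj G
  star_involutive x := by
    induction x using (denseRange_mk G).induction_on with
    | hp => exact isClosed_eq ((continuous_adj G).comp (continuous_adj G)) continuous_id
    | ih a => rw [adj_mk, adj_mk, star_star]
  star_mul x y := by
    change adj G (x * y) = adj G y * adj G x
    induction x, y using (denseRange_mk G).induction_on₂ with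
    | hp =>
      exact isClosed_eq ((continuous_adj G).comp continuous_mul)
        (((continuous_adj G).comp continuous_snd).mul ((continuous_adj G).comp continuous_fst))
    | h a b => rw [← map_mul, adj_mk, adj_mk, adj_mk, star_mul, map_mul]
  star_add x y := by
    change adj G (x + y) = adj G x + adj G y
    induction x, y using (denseRange_mk G).induction_on₂ with
    | hp =>
      exact isClosed_eq ((continuous_adj G).comp continuous_add)
        (((continuous_adj G).comp continuous_fst).add ((continuous_adj G).comp continuous_snd))
    | h a b => rw [← map_add, adj_mk, adj_mk, adj_mk, star_add, map_add]

theorem star_mk (a : G.Poly) : star (mk G a) = mk G (star a) := adj_mk G a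

theorem continuous_star' : Continuous (star : G.UnivCStar → G.UnivCStar) := continuous_adj G

noncomputable instance : CStarAlgebra G.UnivCStar where
  norm_mul_self_le x := by
    induction x using (denseRange_mk G).induction_on with
    | hp =>
      exact isClosed_le (continuous_norm.mul continuous_norm)
        (continuous_norm.comp ((continuous_star' G).mul continuous_id))
    | ih a =>
      rw [star_mk, ← map_mul, norm_mk, norm_mk, ← sq]
      exact (G.univSeminorm_isCKSeminorm.star_mul_self a).ge
  star_smul c x := by
    induction x using (denseRange_mk G).induction_on with
    | hp =>
      exact isClosed_eq ((continuous_star' G).comp (continuous_const_smul c))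
        ((continuous_star' G).const_smul (star c))
    | ih a => rw [← map_smul, star_mk, star_mk, star_smul, map_smul]

end UnivCStar

/-- The (in general non-unital) C*-subalgebra generated by the `s_e` and the `p_A` in the universal
unital C*-algebra. -/
noncomputable def cstarSubalgebra : NonUnitalStarSubalgebra ℂ G.UnivCStar :=
  (NonUnitalStarAlgebra.adjoin ℂ
    ((Set.range fun e => UnivCStar.mk G (G.polyS e)) ∪
      (Set.range fun A => UnivCStar.mk G (G.polyP A)))).topologicalClosure

/-- The ultragraph algebra `C*(𝒢)`: the universal C*-algebra generated by partial isometries `s_e`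
with orthogonal ranges and projections `p_A` subject to the defining relations. (The universal
unital C*-algebra on the same generators is its unitization.) -/
abbrev CStar : Type _ := G.cstarSubalgebra

instance : IsClosed (G.cstarSubalgebra : Set G.UnivCStar) :=
  NonUnitalStarSubalgebra.isClosed_topologicalClosure _

noncomputable instance : NonUnitalCStarAlgebra G.CStar :=
  NonUnitalStarSubalgebra.nonUnitalCStarAlgebra G.cstarSubalgebra

namespace CStar

/-- The generating partial isometry `s_e` of `C*(𝒢)`. -/
noncomputable def s (e : E) : G.CStar :=
  ⟨UnivCStar.mk G (G.polyS e), NonUnitalStarSubalgebra.le_topologicalClosure _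
    (NonUnitalStarAlgebra.subset_adjoin ℂ _ (Or.inl ⟨e, rfl⟩))⟩

/-- The generating projection `p_A` of `C*(𝒢)`. -/
noncomputable def p (A : G.GenVertex) : G.CStar :=
  ⟨UnivCStar.mk G (G.polyP A), NonUnitalStarSubalgebra.le_topologicalClosure _
    (NonUnitalStarAlgebra.subset_adjoin ℂ _ (Or.inr ⟨A, rfl⟩))⟩

end CStar

end Ultragraph

/-! ### Branching systems -/

/-- A `𝒢`-branching system on a measure space `(X, μ)`. The measure on a subset of `X` is
the restriction of `μ`, as a measure on the subtype. -/
structure BranchingSystem {V E : Type*} (G : Ultragraph V E) {X : Type*} [MeasurableSpace X]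
    (μ : Measure X) where
  /-- the sets `R_e` -/
  R : E → Set X
  /-- the sets `D_A` -/
  D : G.GenVertex → Set X
  measurableSet_R : ∀ e, MeasurableSet (R e)
  measurableSet_D : ∀ A, MeasurableSet (D A)
  R_inter : ∀ e e', e ≠ e' → (R e ∩ R e' : Set X) =ᵐ[μ] (∅ : Set X)
  D_empty : D .empty = ∅
  D_inter : ∀ A B, (D A ∩ D B : Set X) =ᵐ[μ] D (A.inter B)
  D_union : ∀ A B, (D A ∪ D B : Set X) =ᵐ[μ] D (A.union B)
  R_subset : ∀ e, R e ≤ᵐ[μ] D (.vertex (G.source e))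
  D_vertex : ∀ v, {e | G.source e = v}.Nonempty → {e | G.source e = v}.Finite →
    D (.vertex v) =ᵐ[μ] ⋃ e ∈ {e | G.source e = v}, R e
  /-- the maps `f_e : D_{r(e)} → R_e` -/
  f : ∀ e, D (.rangeOf e) → R e
  /-- the maps `f_e⁻¹ : R_e → D_{r(e)}` -/
  finv : ∀ e, R e → D (.rangeOf e)
  measurable_f : ∀ e, Measurable (f e)
  measurable_finv : ∀ e, Measurable (finv e)
  f_finv : ∀ e, f e ∘ finv e =ᵐ[μ.comap Subtype.val] id
  finv_f : ∀ e, finv e ∘ f e =ᵐ[μ.comap Subtype.val] id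
  /-- the push-forward `μ ∘ f_e` of `μ` on `R_e` under `f_e⁻¹` is absolutely continuous -/
  map_finv_ac : ∀ e, (μ.comap (Subtype.val : R e → X)).map (finv e) ≪ μ.comap Subtype.val
  /-- the push-forward `μ ∘ f_e⁻¹` of `μ` on `D_{r(e)}` under `f_e` is absolutely continuous -/
  map_f_ac : ∀ e, (μ.comap (Subtype.val : D (.rangeOf e) → X)).map (f e) ≪ μ.comap Subtype.val

namespace BranchingSystem

variable {V E : Type*} {G : Ultragraph V E} {X : Type*} [MeasurableSpace X] {μ : Measure X}

/-- The Radon-Nikodym derivative `Φ_{f_e⁻¹} = d(μ ∘ f_e⁻¹)/dμ` on `R_e`. -/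
noncomputable def PhiInv (b : BranchingSystem G μ) (e : E) : b.R e → ℝ≥0∞ :=
  ((μ.comap (Subtype.val : b.D (.rangeOf e) → X)).map (b.f e)).rnDeriv (μ.comap Subtype.val)

open Classical in
/-- The function `Φ_{f_e⁻¹}^{1/2} · (φ ∘ f_e⁻¹)` on `R_e`, extended by zero to `X`. -/
noncomputable def weightedComp (b : BranchingSystem G μ) (e : E) (φ : X → ℂ) : X → ℂ := fun x =>
  if h : x ∈ b.R e then (Real.sqrt (b.PhiInv e ⟨x, h⟩).toReal : ℂ) * φ (b.finv e ⟨x, h⟩) else 0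

end BranchingSystem

/-! ### Universal properties -/

/-! Existence is the universal property of `C*(𝒢)`: it suffices that S_e = Φ^{1/2}·(φ ∘ f_e⁻¹) and
P_A = multiplication by χ_{D_A} satisfy the defining relations. A family satisfying them extends to
`*`-polynomials, the extension is contractive because `a ↦ ‖ρ a‖` is one of the seminorms in the
supremum, and it passes to the completion (`norm_le_of_rel`, `CKFamily.lift`).

The relations among the P_A are identities of indicator functions. For S_e, two facts suffice, and
no formula for the adjoint is needed. Change of variables (`lintegral_PhiInv_mul`) gives ‖S_e φ‖ =
‖χ_{D_{r(e)}} φ‖, so S_e* S_e = P_{r(e)} by polarization. Since 0 < Φ < ∞ almost everywhere, S_e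
maps onto L²(R_e) (`exists_weightedComp_eq`), so S_e S_e* is multiplication by χ_{R_e}. The
relations left then become the almost everywhere identities between the sets R_e and D_A in the
definition of a branching system.

Uniqueness holds because `*`-homomorphisms of C*-algebras are contractive and the `*`-algebra
generated by the s_e and p_A is dense (`CStar.hom_ext`). -/

namespace FreeStarAlgebra

variable {X A : Type*} [Ring A] [StarRing A]

/-- The value of a word in an algebra with involution. -/
noncomputable def evalWord (g : X → A) : StarWord X →* A :=
  FreeMonoid.lift fun y => if y.2 then star (g y.1) else g y.1

theorem evalWord_adj (g : X → A) (w : StarWord X) :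
    evalWord g (StarWord.adj w) = star (evalWord g w) := by
  induction w using FreeMonoid.inductionOn' with
  | one => simp [StarWord.adj]
  | of_mul y w ih =>
    rw [StarWord.adj_mul, map_mul, map_mul, star_mul, ih]
    congr 1
    rcases y with ⟨x, b⟩
    cases b <;> simp [evalWord, StarWord.adj]

variable [Algebra ℂ A]

/-- The algebra homomorphism out of the free unital `*`-algebra given by the images of the
generators. -/
noncomputable def liftAlgHom (g : X → A) : FreeStarAlgebra X →ₐ[ℂ] A :=
  MonoidAlgebra.lift ℂ A (StarWord X) (evalWord g)

theorem liftAlgHom_mono (g : X → A) (w : StarWord X) (c : ℂ) :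
    liftAlgHom g (mono w c) = c • evalWord g w :=
  MonoidAlgebra.lift_single _ _ _

variable [StarModule ℂ A]

/-- The `*`-homomorphism out of the free unital `*`-algebra given by the images of the
generators. -/
noncomputable def lift (g : X → A) : FreeStarAlgebra X →⋆ₐ[ℂ] A where
  __ := liftAlgHom g
  map_star' a := by
    change liftAlgHom g (star a) = star (liftAlgHom g a)
    induction a using induction_add with
    | zero => simp
    | add a b ha hb => rw [star_add, map_add, map_add, star_add, ha, hb]
    | mono w c => rw [star_mono, liftAlgHom_mono, liftAlgHom_mono, evalWord_adj, star_smul]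

theorem lift_gen (g : X → A) (x : X) : lift g (gen x) = g x := by
  change liftAlgHom g (mono _ 1) = _
  rw [liftAlgHom_mono, one_smul]
  simp [evalWord]

end FreeStarAlgebra

/-! ### Extending Cuntz-Krieger families to `C*(𝒢)` -/

namespace Ultragraph

variable {V E : Type*} {G : Ultragraph V E} {A : Type*} [CStarAlgebra A]

/-- The seminorm `a ↦ ‖ρ a‖`. -/
noncomputable def normComp (ρ : G.Poly →⋆ₐ[ℂ] A) : Seminorm ℂ G.Poly :=
  (normSeminorm ℂ A).comp (ρ : G.Poly →ₐ[ℂ] A).toLinearMap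

theorem normComp_apply (ρ : G.Poly →⋆ₐ[ℂ] A) (a : G.Poly) : normComp ρ a = ‖ρ a‖ := rfl

theorem isCKSeminorm_normComp {ρ : G.Poly →⋆ₐ[ℂ] A} (h : ∀ a b, G.CKRel a b → ρ a = ρ b) :
    G.IsCKSeminorm (normComp ρ) where
  mul_le a b := by
    simp only [normComp_apply, map_mul]
    exact norm_mul_le _ _
  star_mul_self a := by
    simp only [normComp_apply, map_mul, map_star, CStarRing.norm_star_mul_self, sq]
  rel a b hab := by rw [normComp_apply, map_sub, h a b hab, sub_self, norm_zero]

/-- The norm on `G.Poly` is a supremum of seminorms, and `normComp ρ` is one of them. -/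
theorem norm_le_of_rel {ρ : G.Poly →⋆ₐ[ℂ] A} (h : ∀ a b, G.CKRel a b → ρ a = ρ b) (a : G.Poly) :
    ‖ρ a‖ ≤ ‖a‖ := le_univNorm (isCKSeminorm_normComp h) a

theorem continuous_of_rel {ρ : G.Poly →⋆ₐ[ℂ] A} (h : ∀ a b, G.CKRel a b → ρ a = ρ b) :
    Continuous ρ :=
  AddMonoidHomClass.continuous_of_bound ρ 1 fun a => by
    rw [one_mul]
    exact norm_le_of_rel h a

namespace UnivCStar

/-- The extension to the completion of a `*`-homomorphism which respects the defining relations,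
as a ring homomorphism. -/
noncomputable def liftRingHom {ρ : G.Poly →⋆ₐ[ℂ] A} (h : ∀ a b, G.CKRel a b → ρ a = ρ b) :
    G.UnivCStar →+* A :=
  UniformSpace.Completion.extensionHom (α := G.Poly) (ρ : G.Poly →+* A) (continuous_of_rel h)

theorem liftRingHom_mk {ρ : G.Poly →⋆ₐ[ℂ] A} (h : ∀ a b, G.CKRel a b → ρ a = ρ b) (a : G.Poly) :
    liftRingHom h (mk G a) = ρ a :=
  UniformSpace.Completion.extensionHom_coe (α := G.Poly) (ρ : G.Poly →+* A) (continuous_of_rel h) a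

theorem continuous_liftRingHom {ρ : G.Poly →⋆ₐ[ℂ] A} (h : ∀ a b, G.CKRel a b → ρ a = ρ b) :
    Continuous (liftRingHom h) := UniformSpace.Completion.continuous_extension

/-- The extension to the completion of a `*`-homomorphism which respects the defining relations. -/
noncomputable def lift {ρ : G.Poly →⋆ₐ[ℂ] A} (h : ∀ a b, G.CKRel a b → ρ a = ρ b) :
    G.UnivCStar →⋆ₙₐ[ℂ] A where
  __ := liftRingHom h
  map_smul' c x := by
    change liftRingHom h (c • x) = c • liftRingHom h x
    induction x using (denseRange_mk G).induction_on with
    | hp =>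
      exact isClosed_eq ((continuous_liftRingHom h).comp (continuous_const_smul c))
        ((continuous_liftRingHom h).const_smul c)
    | ih a => rw [← map_smul, liftRingHom_mk, liftRingHom_mk, map_smul]
  map_star' x := by
    change liftRingHom h (star x) = star (liftRingHom h x)
    induction x using (denseRange_mk G).induction_on with
    | hp =>
      exact isClosed_eq ((continuous_liftRingHom h).comp (continuous_star' G))
        (continuous_liftRingHom h).star
    | ih a => rw [star_mk, liftRingHom_mk, liftRingHom_mk, map_star]

theorem lift_mk {ρ : G.Poly →⋆ₐ[ℂ] A} (h : ∀ a b, G.CKRel a b → ρ a = ρ b) (a : G.Poly) :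
    lift h (mk G a) = ρ a := liftRingHom_mk h a

end UnivCStar

/-- A family of elements of a unital C*-algebra subject to the defining relations of `C*(𝒢)`. -/
structure CKFamily (G : Ultragraph V E) (A : Type*) [CStarAlgebra A] where
  /-- the partial isometries -/
  S : E → A
  /-- the projections -/
  P : G.GenVertex → A
  partial_isometry : ∀ e, S e * star (S e) * S e = S e
  orthogonal : ∀ e f, e ≠ f → star (S e) * S f = 0
  selfAdjoint : ∀ B, star (P B) = P B
  idempotent : ∀ B, P B * P B = P B
  empty : P .empty = 0
  inter : ∀ B C, P B * P C = P (B.inter C)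
  union : ∀ B C, P (B.union C) = P B + P C - P (B.inter C)
  range : ∀ e, star (S e) * S e = P (.rangeOf e)
  source : ∀ e, P (.vertex (G.source e)) * (S e * star (S e)) = S e * star (S e)
  vertex : ∀ v (T : Finset E), T.Nonempty → (∀ e, e ∈ T ↔ G.source e = v) →
    P (.vertex v) = ∑ e ∈ T, S e * star (S e)

namespace CKFamily

/-- The `*`-homomorphism on `*`-polynomials given by a Cuntz-Krieger family. -/
noncomputable def polyHom (F : G.CKFamily A) : G.Poly →⋆ₐ[ℂ] A :=
  FreeStarAlgebra.lift (Sum.elim F.S F.P)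

theorem polyHom_polyS (F : G.CKFamily A) (e : E) : F.polyHom (G.polyS e) = F.S e :=
  FreeStarAlgebra.lift_gen _ _

theorem polyHom_polyP (F : G.CKFamily A) (B : G.GenVertex) : F.polyHom (G.polyP B) = F.P B :=
  FreeStarAlgebra.lift_gen _ _

theorem polyHom_rel (F : G.CKFamily A) (a b : G.Poly) (h : G.CKRel a b) :
    F.polyHom a = F.polyHom b := by
  induction h with
  | partial_isometry e =>
    simpa only [map_mul, map_star, polyHom_polyS] using F.partial_isometry e
  | orthogonal e f hef =>
    simpa only [map_mul, map_star, map_zero, polyHom_polyS] using F.orthogonal e f hef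
  | selfAdjoint B => simpa only [map_star, polyHom_polyP] using F.selfAdjoint B
  | idempotent B => simpa only [map_mul, polyHom_polyP] using F.idempotent B
  | empty => simpa only [map_zero, polyHom_polyP] using F.empty
  | inter B C => simpa only [map_mul, polyHom_polyP] using F.inter B C
  | union B C => simpa only [map_add, map_sub, polyHom_polyP] using F.union B C
  | range e => simpa only [map_mul, map_star, polyHom_polyS, polyHom_polyP] using F.range e
  | source e => simpa only [map_mul, map_star, polyHom_polyS, polyHom_polyP] using F.source e
  | vertex v T hT h =>
    simpa only [map_sum, map_mul, map_star, polyHom_polyS, polyHom_polyP] using F.vertex v T hT h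

/-- The universal property of `C*(𝒢)`. -/
noncomputable def lift (F : G.CKFamily A) : G.CStar →⋆ₙₐ[ℂ] A :=
  -- The homomorphism on the unitization is restricted, so the result need not be nondegenerate.
  (UnivCStar.lift F.polyHom_rel).comp (NonUnitalStarSubalgebraClass.subtype G.cstarSubalgebra)

theorem lift_s (F : G.CKFamily A) (e : E) : F.lift (CStar.s G e) = F.S e :=
  (UnivCStar.lift_mk F.polyHom_rel _).trans (F.polyHom_polyS e)

theorem lift_p (F : G.CKFamily A) (B : G.GenVertex) : F.lift (CStar.p G B) = F.P B :=
  (UnivCStar.lift_mk F.polyHom_rel _).trans (F.polyHom_polyP B)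

end CKFamily

/-! ### Uniqueness of homomorphisms on `C*(𝒢)` -/

namespace CStar

/-- `*`-homomorphisms on `C*(𝒢)` are determined by the images of the generators. -/
theorem hom_ext {π π' : G.CStar →⋆ₙₐ[ℂ] A} (hs : ∀ e, π (s G e) = π' (s G e))
    (hp : ∀ B, π (p G B) = π' (p G B)) : π = π' := by
  -- Automatic continuity: `*`-homomorphisms between C*-algebras are contractive.
  have hcont : ∀ σ : G.CStar →⋆ₙₐ[ℂ] A, Continuous σ := fun σ =>
    AddMonoidHomClass.continuous_of_bound σ 1 fun a => by
      rw [one_mul]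
      exact NonUnitalStarAlgHom.norm_apply_le σ a
  let adj := NonUnitalStarAlgebra.adjoin ℂ
    ((Set.range fun e => UnivCStar.mk G (G.polyS e)) ∪
      (Set.range fun A => UnivCStar.mk G (G.polyP A)))
  have hle : adj ≤ G.cstarSubalgebra := NonUnitalStarSubalgebra.le_topologicalClosure _
  have hadj : ∀ x (hx : x ∈ adj), π ⟨x, hle hx⟩ = π' ⟨x, hle hx⟩ := by
    intro x hx
    induction hx using NonUnitalStarAlgebra.adjoin_induction with
    | mem x hx =>
      rcases hx with ⟨e, rfl⟩ | ⟨B, rfl⟩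
      · exact hs e
      · exact hp B
    | add x y hx hy h₁ h₂ =>
      have := congrArg₂ (· + ·) h₁ h₂
      simp only [← map_add] at this
      exact this
    | zero => exact (map_zero π).trans (map_zero π').symm
    | mul x y hx hy h₁ h₂ =>
      have := congrArg₂ (· * ·) h₁ h₂
      simp only [← map_mul] at this
      exact this
    | smul c x hx h =>
      have := congrArg (c • ·) h
      simp only [← map_smul] at this
      exact this
    | star x hx h =>
      have := congrArg star h
      simp only [← map_star] at this
      exact this
  -- `C*(𝒢)` is by definition the closure of `adj`; only the passage to the subspace topology is at
  -- issue.
  have hdense : Dense {x : G.CStar | x.1 ∈ adj} := by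
    intro x
    rw [closure_subtype]
    refine closure_mono ?_ (show x.1 ∈ closure (adj : Set G.UnivCStar) from x.2)
    exact fun y hy => ⟨⟨y, hle hy⟩, hy, rfl⟩
  refine DFunLike.coe_injective ((hcont π).ext_on hdense (hcont π') ?_)
  exact fun x hx => hadj x.1 hx

end CStar

end Ultragraph

/-! ### Operators on `L²` -/

section LpOperators

variable {X : Type*} [MeasurableSpace X] {μ : Measure X}

/-- The operator on `L²` given by a linear map of functions which respects equality almost
everywhere and does not increase the `L²`-seminorm. -/
noncomputable def clmOfFun (T : (X → ℂ) →ₗ[ℂ] (X → ℂ))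
    (hae : ∀ φ ψ : X → ℂ, φ =ᵐ[μ] ψ → T φ =ᵐ[μ] T ψ)
    (hm : ∀ φ, StronglyMeasurable φ → AEStronglyMeasurable (T φ) μ)
    (hle : ∀ φ, StronglyMeasurable φ → eLpNorm (T φ) 2 μ ≤ eLpNorm φ 2 μ) :
    Lp ℂ 2 μ →L[ℂ] Lp ℂ 2 μ :=
  -- The chosen representative of a class in L² is strongly measurable, so `hm` and `hle` are needed
  -- for such functions only.
  have hmem : ∀ φ : Lp ℂ 2 μ, MemLp (T φ) 2 μ := fun φ =>
    ⟨hm φ (Lp.stronglyMeasurable φ), (hle φ (Lp.stronglyMeasurable φ)).trans_lt (Lp.memLp φ).2⟩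
  LinearMap.mkContinuous
    { toFun := fun φ => (hmem φ).toLp
      map_add' := fun φ ψ => by
        rw [← MemLp.toLp_add]
        refine MemLp.toLp_congr _ _ ?_
        rw [← map_add]
        exact hae _ _ (Lp.coeFn_add φ ψ)
      map_smul' := fun c φ => by
        rw [RingHom.id_apply, ← MemLp.toLp_const_smul]
        refine MemLp.toLp_congr _ _ ?_
        rw [← map_smul]
        exact hae _ _ (Lp.coeFn_smul c φ) }
    1 fun φ => by
      rw [one_mul]
      change ‖(hmem φ).toLp‖ ≤ ‖φ‖
      rw [Lp.norm_toLp, Lp.norm_def]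
      exact ENNReal.toReal_mono (Lp.memLp φ).2.ne (hle φ (Lp.stronglyMeasurable φ))

theorem coeFn_clmOfFun {T : (X → ℂ) →ₗ[ℂ] (X → ℂ)}
    (hae : ∀ φ ψ : X → ℂ, φ =ᵐ[μ] ψ → T φ =ᵐ[μ] T ψ)
    (hm : ∀ φ, StronglyMeasurable φ → AEStronglyMeasurable (T φ) μ)
    (hle : ∀ φ, StronglyMeasurable φ → eLpNorm (T φ) 2 μ ≤ eLpNorm φ 2 μ) (φ : Lp ℂ 2 μ) :
    clmOfFun T hae hm hle φ =ᵐ[μ] T φ :=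
  MemLp.coeFn_toLp
    ⟨hm φ (Lp.stronglyMeasurable φ), (hle φ (Lp.stronglyMeasurable φ)).trans_lt (Lp.memLp φ).2⟩

/-- The indicator as a linear map of functions. -/
noncomputable def indicatorLinearMap (A : Set X) : (X → ℂ) →ₗ[ℂ] (X → ℂ) where
  toFun := A.indicator
  map_add' := Set.indicator_add' A
  map_smul' := Set.indicator_const_smul A

theorem Filter.EventuallyEq.indicator_congr_right {A : Set X} {φ ψ : X → ℂ} (h : φ =ᵐ[μ] ψ) :
    A.indicator φ =ᵐ[μ] A.indicator ψ := by
  filter_upwards [h] with x hx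
  simp only [Set.indicator, hx]

/-- Multiplication by the characteristic function of a measurable set, as an operator on `L²`. -/
noncomputable def indicatorCLM (μ : Measure X) {A : Set X} (hA : MeasurableSet A) :
    Lp ℂ 2 μ →L[ℂ] Lp ℂ 2 μ :=
  clmOfFun (indicatorLinearMap A) (fun _ _ h => h.indicator_congr_right)
    (fun _ h => (h.indicator hA).aestronglyMeasurable) (fun φ _ => eLpNorm_indicator_le φ)

theorem coeFn_indicatorCLM {A : Set X} (hA : MeasurableSet A) (φ : Lp ℂ 2 μ) :
    indicatorCLM μ hA φ =ᵐ[μ] A.indicator φ :=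
  coeFn_clmOfFun _ _ _ φ

theorem indicatorCLM_congr {A B : Set X} (hA : MeasurableSet A) (hB : MeasurableSet B)
    (h : A =ᵐ[μ] B) : indicatorCLM μ hA = indicatorCLM μ hB := by
  ext1 φ
  refine Lp.ext ?_
  exact (coeFn_indicatorCLM hA φ).trans
    ((indicator_ae_eq_of_ae_eq_set h).trans (coeFn_indicatorCLM hB φ).symm)

theorem indicatorCLM_mul {A B : Set X} (hA : MeasurableSet A) (hB : MeasurableSet B) :
    indicatorCLM μ hA * indicatorCLM μ hB = indicatorCLM μ (hA.inter hB) := by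
  ext1 φ
  refine Lp.ext ?_
  refine (coeFn_indicatorCLM hA (indicatorCLM μ hB φ)).trans ?_
  refine ((coeFn_indicatorCLM hB φ).indicator_congr_right).trans ?_
  rw [Set.indicator_indicator]
  exact (coeFn_indicatorCLM _ φ).symm

theorem indicatorCLM_empty : indicatorCLM μ MeasurableSet.empty = 0 := by
  ext1 φ
  refine Lp.ext ?_
  refine (coeFn_indicatorCLM _ φ).trans ?_
  rw [Set.indicator_empty']
  exact (Lp.coeFn_zero ℂ 2 μ).symm

theorem indicatorCLM_eq_zero {A : Set X} (hA : MeasurableSet A) (h : A =ᵐ[μ] (∅ : Set X)) :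
    indicatorCLM μ hA = 0 :=
  (indicatorCLM_congr hA .empty h).trans indicatorCLM_empty

theorem indicatorCLM_union {A B : Set X} (hA : MeasurableSet A) (hB : MeasurableSet B) :
    indicatorCLM μ (hA.union hB)
      = indicatorCLM μ hA + indicatorCLM μ hB - indicatorCLM μ (hA.inter hB) := by
  rw [eq_sub_iff_add_eq]
  ext1 φ
  refine Lp.ext ?_
  refine (Lp.coeFn_add _ _).trans (.trans ?_ (Lp.coeFn_add _ _).symm)
  refine ((coeFn_indicatorCLM _ φ).add (coeFn_indicatorCLM _ φ)).trans
    (.trans ?_ ((coeFn_indicatorCLM _ φ).add (coeFn_indicatorCLM _ φ)).symm)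
  rw [Set.indicator_union_add_inter]

theorem star_indicatorCLM {A : Set X} (hA : MeasurableSet A) :
    star (indicatorCLM μ hA) = indicatorCLM μ hA := by
  rw [ContinuousLinearMap.star_eq_adjoint, eq_comm, ContinuousLinearMap.eq_adjoint_iff]
  intro φ ψ
  rw [L2.inner_def, L2.inner_def]
  refine integral_congr_ae ?_
  filter_upwards [coeFn_indicatorCLM hA φ, coeFn_indicatorCLM hA ψ] with x hφ hψ
  rw [hφ, hψ]
  by_cases hx : x ∈ A <;> simp [hx]

theorem indicatorCLM_finset_biUnion {ι : Type*} {R : ι → Set X} (hR : ∀ i, MeasurableSet (R i))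
    (hdisj : ∀ i j, i ≠ j → (R i ∩ R j : Set X) =ᵐ[μ] (∅ : Set X)) (T : Finset ι) :
    indicatorCLM μ (T.measurableSet_biUnion fun i _ => hR i) = ∑ i ∈ T, indicatorCLM μ (hR i) := by
  classical
  induction T using Finset.induction_on with
  | empty => exact indicatorCLM_eq_zero _ (by simp)
  | insert i T hi ih =>
    have hT := T.measurableSet_biUnion fun j _ => hR j
    -- The correction term of inclusion-exclusion: by induction it is a sum of products of
    -- projections for pairwise almost disjoint sets.
    have h0 : indicatorCLM μ ((hR i).inter hT) = 0 := by
      rw [← indicatorCLM_mul (hR i) hT, ih, Finset.mul_sum]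
      refine Finset.sum_eq_zero fun j hj => ?_
      rw [indicatorCLM_mul]
      exact indicatorCLM_eq_zero _ (hdisj i j (ne_of_mem_of_not_mem hj hi).symm)
    rw [Finset.sum_insert hi, ← ih, ← sub_zero (_ + _), ← h0, ← indicatorCLM_union (hR i) hT]
    exact indicatorCLM_congr _ _ (.of_eq (Finset.set_biUnion_insert i T R))

/-- Both `star S * S` and `star P * P` have the quadratic form ‖S x‖² = ‖P x‖², and on a complex
Hilbert space the quadratic form determines the operator. -/
theorem star_mul_self_eq_of_norm_eq {H : Type*} [NormedAddCommGroup H] [InnerProductSpace ℂ H]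
    [CompleteSpace H] {S P : H →L[ℂ] H} (hP : star P = P) (hPP : P * P = P)
    (h : ∀ x, ‖S x‖ = ‖P x‖) : star S * S = P := by
  have key : ∀ (T : H →L[ℂ] H) x, inner ℂ ((star T * T) x) x = (‖T x‖ : ℂ) ^ 2 := fun T x => by
    rw [ContinuousLinearMap.star_eq_adjoint, mul_apply_eq_comp,
      ContinuousLinearMap.adjoint_inner_left, inner_self_eq_norm_sq_to_K]
    rfl
  have h1 : ((star S * S : H →L[ℂ] H) : H →ₗ[ℂ] H) = (star P * P : H →L[ℂ] H) :=
    (ext_inner_map _ _).1 fun x => (key S x).trans ((h x ▸ rfl : _ = _).trans (key P x).symm)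
  rw [ContinuousLinearMap.coe_inj.1 h1, hP, hPP]

end LpOperators

/-! ### The representation of a branching system -/

namespace BranchingSystem

variable {V E : Type*} {G : Ultragraph V E} {X : Type*} [MeasurableSpace X] {μ : Measure X}
  (b : BranchingSystem G μ) (e : E)

/-! ### Transport of measure along f_e and the Radon-Nikodym derivative -/

theorem map_finv_map_f :
    ((μ.comap (Subtype.val : b.D (.rangeOf e) → X)).map (b.f e)).map (b.finv e)
      = μ.comap Subtype.val := by
  rw [Measure.map_map (b.measurable_finv e) (b.measurable_f e), Measure.map_congr (b.finv_f e),
    Measure.map_id]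

theorem map_f_map_finv :
    ((μ.comap (Subtype.val : b.R e → X)).map (b.finv e)).map (b.f e) = μ.comap Subtype.val := by
  rw [Measure.map_map (b.measurable_f e) (b.measurable_finv e), Measure.map_congr (b.f_finv e),
    Measure.map_id]

/-- This is μ ∘ f_e ≪ μ pushed forward by f_e. It makes Φ positive almost everywhere. -/
theorem ac_map_f : μ.comap (Subtype.val : b.R e → X)
    ≪ (μ.comap (Subtype.val : b.D (.rangeOf e) → X)).map (b.f e) := by
  conv_lhs => rw [← map_f_map_finv]
  exact (b.map_finv_ac e).map (b.measurable_f e)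

theorem sigmaFinite_comap_val [SigmaFinite μ] {A : Set X} (hA : MeasurableSet A) :
    SigmaFinite (μ.comap (Subtype.val : A → X)) := by
  refine SigmaFinite.of_map _ measurable_subtype_coe.aemeasurable ?_
  rw [map_comap_subtype_coe hA]
  infer_instance

/-- Push-forwards of σ-finite measures need not be σ-finite. Here a further push-forward under f_e⁻¹
returns μ on D_{r(e)}, and σ-finiteness of an image measure passes back to its source. -/
instance sigmaFinite_map_f [SigmaFinite μ] :
    SigmaFinite ((μ.comap (Subtype.val : b.D (.rangeOf e) → X)).map (b.f e)) := by
  refine SigmaFinite.of_map _ (b.measurable_finv e).aemeasurable ?_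
  rw [map_finv_map_f]
  exact sigmaFinite_comap_val (b.measurableSet_D _)

theorem measurable_PhiInv : Measurable (b.PhiInv e) := Measure.measurable_rnDeriv _ _

theorem PhiInv_lt_top [SigmaFinite μ] : ∀ᵐ x ∂μ.comap (Subtype.val : b.R e → X),
    b.PhiInv e x < ∞ := by
  have := sigmaFinite_comap_val (μ := μ) (b.measurableSet_R e)
  exact Measure.rnDeriv_lt_top _ _

/-- A density is positive almost everywhere for the measure it defines; `ac_map_f` transfers this to
μ. -/
theorem PhiInv_pos [SigmaFinite μ] : ∀ᵐ x ∂μ.comap (Subtype.val : b.R e → X),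
    0 < b.PhiInv e x := by
  have := sigmaFinite_comap_val (μ := μ) (b.measurableSet_R e)
  exact (b.ac_map_f e).ae_le (Measure.rnDeriv_pos (b.map_f_ac e))

/-- Change of variables: Φ dμ = d(μ ∘ f_e⁻¹), and f_e⁻¹(f_e y) = y for almost every y. -/
theorem lintegral_PhiInv_mul [SigmaFinite μ] {g : X → ℝ≥0∞} (hg : Measurable g) :
    ∫⁻ x, b.PhiInv e x * g (b.finv e x) ∂μ.comap (Subtype.val : b.R e → X)
      = ∫⁻ y in b.D (.rangeOf e), g y ∂μ := by
  have := sigmaFinite_comap_val (μ := μ) (b.measurableSet_R e)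
  have hm : Measurable fun x => g (b.finv e x) :=
    hg.comp (measurable_subtype_coe.comp (b.measurable_finv e))
  rw [← lintegral_subtype_comap (b.measurableSet_D _)]
  refine (lintegral_rnDeriv_mul (b.map_f_ac e) hm.aemeasurable).trans ?_
  rw [lintegral_map hm (b.measurable_f e)]
  refine lintegral_congr_ae ?_
  filter_upwards [b.finv_f e] with y hy
  have : b.finv e (b.f e y) = y := hy
  rw [this]

/-- The weighted composition as a linear map of functions. -/
noncomputable def weightedCompLinearMap : (X → ℂ) →ₗ[ℂ] (X → ℂ) where
  toFun := b.weightedComp e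
  map_add' φ ψ := by
    funext x
    by_cases hx : x ∈ b.R e <;> simp [weightedComp, hx, mul_add]
  map_smul' c φ := by
    funext x
    by_cases hx : x ∈ b.R e <;> simp [weightedComp, hx, mul_left_comm]

/-! ### Weighted composition on functions -/

variable {b e}

theorem weightedComp_of_mem {φ : X → ℂ} (x : b.R e) : b.weightedComp e φ x
    = (Real.sqrt (b.PhiInv e x).toReal : ℂ) * φ (b.finv e x) := by
  simp [weightedComp]

theorem weightedComp_of_notMem {φ : X → ℂ} {x : X} (hx : x ∉ b.R e) :
    b.weightedComp e φ x = 0 := by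
  simp [weightedComp, hx]

theorem ae_of_ae_comap_val {A : Set X} (hA : MeasurableSet A) {p : X → Prop}
    (h : ∀ᵐ x : A ∂μ.comap Subtype.val, p x) (hp : ∀ x ∉ A, p x) : ∀ᵐ x ∂μ, p x := by
  have h1 := (ae_restrict_iff' hA).1 ((ae_restrict_iff_subtype hA).2 h)
  filter_upwards [h1] with x hx
  exact (em (x ∈ A)).elim hx (hp x)

/-- The hypothesis μ ∘ f_e ≪ μ says that preimages of null sets under f_e⁻¹ are null; this makes φ ∘
f_e⁻¹ well defined on classes. -/
theorem weightedComp_congr_ae {φ ψ : X → ℂ} (h : φ =ᵐ[μ] ψ) :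
    b.weightedComp e φ =ᵐ[μ] b.weightedComp e ψ := by
  have hD : ∀ᵐ y : b.D (.rangeOf e) ∂μ.comap Subtype.val, φ y = ψ y :=
    (ae_restrict_iff_subtype (b.measurableSet_D _)).1 (ae_restrict_of_ae h)
  have hR := ae_of_ae_map (b.measurable_finv e).aemeasurable ((b.map_finv_ac e).ae_le hD)
  refine ae_of_ae_comap_val (b.measurableSet_R e) ?_ fun x hx => ?_
  · filter_upwards [hR] with x hx
    rw [weightedComp_of_mem, weightedComp_of_mem, hx]
  · rw [weightedComp_of_notMem hx, weightedComp_of_notMem hx]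

theorem measurable_weightedComp {φ : X → ℂ} (hφ : Measurable φ) :
    Measurable (b.weightedComp e φ) := by
  classical
  have h : Measurable fun x : b.R e =>
      (Real.sqrt (b.PhiInv e x).toReal : ℂ) * φ (b.finv e x) :=
    (Complex.measurable_ofReal.comp (b.measurable_PhiInv e).ennreal_toReal.sqrt).mul
      (hφ.comp (measurable_subtype_coe.comp (b.measurable_finv e)))
  convert h.dite (g := fun _ => (0 : ℂ)) measurable_const (b.measurableSet_R e) using 1
  funext x
  by_cases hx : x ∈ b.R e <;> simp [weightedComp, hx]

theorem eLpNorm_weightedComp [SigmaFinite μ] {φ : X → ℂ} (hφ : Measurable φ) :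
    eLpNorm (b.weightedComp e φ) 2 μ = eLpNorm ((b.D (.rangeOf e)).indicator φ) 2 μ := by
  rw [eLpNorm_indicator_eq_eLpNorm_restrict (b.measurableSet_D _),
    eLpNorm_eq_lintegral_rpow_enorm_toReal two_ne_zero ENNReal.ofNat_ne_top,
    eLpNorm_eq_lintegral_rpow_enorm_toReal two_ne_zero ENNReal.ofNat_ne_top,
    ENNReal.toReal_ofNat]
  congr 1
  rw [← b.lintegral_PhiInv_mul e (hφ.enorm.pow_const 2)]
  have h0 : (fun x => ‖b.weightedComp e φ x‖ₑ ^ (2 : ℝ))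
      = (b.R e).indicator fun x => ‖b.weightedComp e φ x‖ₑ ^ (2 : ℝ) := by
    refine (Set.indicator_eq_self.2 fun x hx => ?_).symm
    by_contra h
    exact hx (by simp [weightedComp_of_notMem h])
  rw [h0, lintegral_indicator (b.measurableSet_R e),
    ← lintegral_subtype_comap (b.measurableSet_R e)]
  refine lintegral_congr_ae ?_
  -- Finiteness is needed because `toReal` sends ∞ to 0; where Φ < ∞, the square of the root is Φ.
  filter_upwards [b.PhiInv_lt_top e] with x hx
  rw [weightedComp_of_mem, enorm_mul, ENNReal.mul_rpow_of_nonneg _ _ zero_le_two]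
  congr 1
  rw [← ofReal_norm, Complex.norm_real, Real.norm_of_nonneg (Real.sqrt_nonneg _),
    ENNReal.rpow_two, ← ENNReal.ofReal_pow (Real.sqrt_nonneg _),
    Real.sq_sqrt ENNReal.toReal_nonneg, ENNReal.ofReal_toReal hx.ne]

open Classical in
/-- Every function on `R_e` is, almost everywhere, the weighted composition of a function
on `D_{r(e)}`. -/
theorem exists_weightedComp_eq [SigmaFinite μ] {ψ : X → ℂ} (hψ : Measurable ψ) :
    ∃ φ : X → ℂ, Measurable φ ∧ (b.D (.rangeOf e)).indicator φ = φ ∧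
      b.weightedComp e φ =ᵐ[μ] (b.R e).indicator ψ := by
  -- The solution of Φ(x)^{1/2} φ(f_e⁻¹ x) = ψ(x) with x = f_e y.
  let g : b.D (.rangeOf e) → ℂ := fun y =>
    (Real.sqrt (b.PhiInv e (b.f e y)).toReal : ℂ)⁻¹ * ψ (b.f e y)
  have hg : Measurable g :=
    (Complex.measurable_ofReal.comp ((b.measurable_PhiInv e).comp
      (b.measurable_f e)).ennreal_toReal.sqrt).inv.mul
      (hψ.comp (measurable_subtype_coe.comp (b.measurable_f e)))
  refine ⟨fun y => if h : y ∈ b.D (.rangeOf e) then g ⟨y, h⟩ else 0,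
    hg.dite (g := fun _ => (0 : ℂ)) measurable_const (b.measurableSet_D _), ?_, ?_⟩
  · refine Set.indicator_eq_self.2 fun y hy => ?_
    by_contra h
    exact hy (by simp [h])
  · refine ae_of_ae_comap_val (b.measurableSet_R e) ?_ fun x hx => ?_
    · filter_upwards [b.PhiInv_lt_top e, b.PhiInv_pos e, b.f_finv e] with x h1 h2 h3
      have h3 : b.f e (b.finv e x) = x := h3
      have h4 : (Real.sqrt (b.PhiInv e x).toReal : ℂ) ≠ 0 :=
        Complex.ofReal_ne_zero.2 (Real.sqrt_pos.2 (ENNReal.toReal_pos h2.ne' h1.ne)).ne'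
      rw [weightedComp_of_mem, Set.indicator_of_mem x.2, dif_pos (b.finv e x).2]
      simp only [g, Subtype.coe_eta, h3]
      rw [mul_inv_cancel_left₀ h4]
    · rw [weightedComp_of_notMem hx, Set.indicator_of_notMem hx]

/-! ### The operators S_e and their relations -/

variable (b e) [SigmaFinite μ]

/-- The weighted composition as an operator on `L²`. -/
noncomputable def weightedCompCLM : Lp ℂ 2 μ →L[ℂ] Lp ℂ 2 μ :=
  clmOfFun (b.weightedCompLinearMap e) (fun _ _ => weightedComp_congr_ae)
    (fun _ h => (measurable_weightedComp h.measurable).aestronglyMeasurable)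
    (fun φ h => (eLpNorm_weightedComp h.measurable).trans_le (eLpNorm_indicator_le φ))

theorem coeFn_weightedCompCLM (φ : Lp ℂ 2 μ) :
    b.weightedCompCLM e φ =ᵐ[μ] b.weightedComp e φ :=
  coeFn_clmOfFun _ _ _ φ

/-- Multiplication by the characteristic function of `R_e`. -/
noncomputable abbrev projR : Lp ℂ 2 μ →L[ℂ] Lp ℂ 2 μ := indicatorCLM μ (b.measurableSet_R e)

/-- Multiplication by the characteristic function of `D_A`. -/
noncomputable abbrev projD (A : G.GenVertex) : Lp ℂ 2 μ →L[ℂ] Lp ℂ 2 μ :=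
  indicatorCLM μ (b.measurableSet_D A)

theorem projR_mul_weightedCompCLM : b.projR e * b.weightedCompCLM e = b.weightedCompCLM e := by
  ext1 φ
  refine Lp.ext ?_
  refine (coeFn_indicatorCLM (b.measurableSet_R e) _).trans ?_
  refine (coeFn_weightedCompCLM b e φ).indicator_congr_right.trans
    (.trans ?_ (coeFn_weightedCompCLM b e φ).symm)
  rw [Set.indicator_eq_self.2]
  intro x hx
  by_contra h
  exact hx (weightedComp_of_notMem h)

/-- f_e⁻¹ takes its values in D_{r(e)}, so S_e does not see φ outside that set. -/
theorem weightedCompCLM_mul_projD :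
    b.weightedCompCLM e * b.projD (.rangeOf e) = b.weightedCompCLM e := by
  ext1 φ
  refine Lp.ext ?_
  refine (coeFn_weightedCompCLM b e _).trans (.trans ?_ (coeFn_weightedCompCLM b e φ).symm)
  refine (weightedComp_congr_ae (coeFn_indicatorCLM _ φ)).trans (.of_eq ?_)
  funext x
  by_cases hx : x ∈ b.R e <;> simp [weightedComp, hx]

theorem star_weightedCompCLM_mul_self :
    star (b.weightedCompCLM e) * b.weightedCompCLM e = b.projD (.rangeOf e) := by
  refine star_mul_self_eq_of_norm_eq (star_indicatorCLM _) ?_ fun φ => ?_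
  · rw [indicatorCLM_mul]
    exact indicatorCLM_congr _ _ (.of_eq (Set.inter_self _))
  · rw [Lp.norm_def, Lp.norm_def, eLpNorm_congr_ae (coeFn_weightedCompCLM b e φ),
      eLpNorm_congr_ae (coeFn_indicatorCLM _ φ),
      eLpNorm_weightedComp (Lp.stronglyMeasurable φ).measurable]

/-- Surjectivity of S_e onto L²(R_e), from which the range projection is identified. -/
theorem exists_weightedCompCLM_eq (ψ : Lp ℂ 2 μ) :
    ∃ φ, b.weightedCompCLM e φ = b.projR e ψ := by
  obtain ⟨φ, hm, hD, h⟩ := exists_weightedComp_eq (b := b) (e := e)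
    (Lp.stronglyMeasurable ψ).measurable
  have hmem : MemLp φ 2 μ := by
    refine ⟨hm.aestronglyMeasurable, ?_⟩
    -- φ vanishes off D_{r(e)}, so its L² norm is that of its weighted composition, namely of
    -- χ_{R_e} ψ.
    rw [← hD, ← eLpNorm_weightedComp hm, eLpNorm_congr_ae h]
    exact (eLpNorm_indicator_le _).trans_lt (Lp.memLp ψ).2
  refine ⟨hmem.toLp, Lp.ext ?_⟩
  exact (coeFn_weightedCompCLM b e _).trans ((weightedComp_congr_ae hmem.coeFn_toLp).trans
    (h.trans (coeFn_indicatorCLM _ ψ).symm))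

theorem weightedCompCLM_mul_star_mul_self :
    b.weightedCompCLM e * star (b.weightedCompCLM e) * b.weightedCompCLM e
      = b.weightedCompCLM e := by
  rw [mul_assoc, star_weightedCompCLM_mul_self, weightedCompCLM_mul_projD]

theorem star_weightedCompCLM_mul_projR :
    star (b.weightedCompCLM e) * b.projR e = star (b.weightedCompCLM e) := by
  conv_rhs => rw [← projR_mul_weightedCompCLM, star_mul, star_indicatorCLM]

/-- If χ_{R_e} ψ = S φ, then S S* ψ = S S* χ_{R_e} ψ = S S* S φ = S φ. -/
theorem weightedCompCLM_mul_star :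
    b.weightedCompCLM e * star (b.weightedCompCLM e) = b.projR e := by
  rw [← star_weightedCompCLM_mul_projR]
  ext1 ψ
  obtain ⟨φ, hφ⟩ := b.exists_weightedCompCLM_eq e ψ
  have h := congrArg (· φ) (b.weightedCompCLM_mul_star_mul_self e)
  simp only [mul_apply_eq_comp] at h ⊢
  rw [← hφ, h]

/-- The Cuntz-Krieger family of a branching system. -/
noncomputable def ckFamily : G.CKFamily (Lp ℂ 2 μ →L[ℂ] Lp ℂ 2 μ) where
  S e := b.weightedCompCLM e
  P A := b.projD A
  partial_isometry e := b.weightedCompCLM_mul_star_mul_self e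
  orthogonal e f hef := by
    -- S_e* S_f = S_e* χ_{R_e} χ_{R_f} S_f, and R_e ∩ R_f is null.
    rw [← star_weightedCompCLM_mul_projR, ← projR_mul_weightedCompCLM b f, mul_assoc,
      ← mul_assoc (b.projR e), indicatorCLM_mul, indicatorCLM_eq_zero _ (b.R_inter e f hef),
      zero_mul, mul_zero]
  selfAdjoint A := star_indicatorCLM _
  idempotent A := by
    rw [indicatorCLM_mul]
    exact indicatorCLM_congr _ _ (.of_eq (Set.inter_self _))
  empty := indicatorCLM_eq_zero _ (.of_eq b.D_empty)
  inter A B := by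
    rw [indicatorCLM_mul]
    exact indicatorCLM_congr _ _ (b.D_inter A B)
  union A B := by
    have hA := b.measurableSet_D A
    have hB := b.measurableSet_D B
    rw [projD, projD, projD, projD, ← indicatorCLM_congr (hA.union hB) _ (b.D_union A B),
      ← indicatorCLM_congr (hA.inter hB) _ (b.D_inter A B), indicatorCLM_union hA hB]
  range e := b.star_weightedCompCLM_mul_self e
  source e := by
    rw [weightedCompCLM_mul_star, indicatorCLM_mul]
    -- What remains is D_{s(e)} ∩ R_e = R_e almost everywhere.
    refine indicatorCLM_congr _ _ ?_
    filter_upwards [b.R_subset e] with x hx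
    exact propext ⟨And.right, fun h => ⟨hx h, h⟩⟩
  vertex v T hT h := by
    have hset : {e | G.source e = v} = T := Set.ext fun e => (h e).symm
    have hD := b.D_vertex v (hset ▸ hT) (hset ▸ T.finite_toSet)
    rw [hset] at hD
    simp only [weightedCompCLM_mul_star]
    rw [← indicatorCLM_finset_biUnion b.measurableSet_R b.R_inter T]
    exact indicatorCLM_congr _ _ hD

end BranchingSystem

theorem mainTheorem4 {V E : Type*} (G : Ultragraph V E) {X : Type*} [MeasurableSpace X]
    (μ : Measure X) [SigmaFinite μ] (b : BranchingSystem G μ) :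
    ∃! π : G.CStar →⋆ₙₐ[ℂ] (Lp ℂ 2 μ →L[ℂ] Lp ℂ 2 μ),
      (∀ (e : E) (φ : Lp ℂ 2 μ),
        (π (Ultragraph.CStar.s G e) φ : X → ℂ) =ᵐ[μ] b.weightedComp e φ) ∧
      (∀ (A : G.GenVertex) (φ : Lp ℂ 2 μ),
        (π (Ultragraph.CStar.p G A) φ : X → ℂ) =ᵐ[μ] (b.D A).indicator φ) := by
  refine ⟨b.ckFamily.lift, ⟨fun e φ => ?_, fun A φ => ?_⟩, ?_⟩
  · rw [Ultragraph.CKFamily.lift_s]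
    exact b.coeFn_weightedCompCLM e φ
  · rw [Ultragraph.CKFamily.lift_p]
    exact coeFn_indicatorCLM (b.measurableSet_D A) φ
  · rintro π ⟨hs, hp⟩
    refine Ultragraph.CStar.hom_ext (fun e => ?_) fun A => ?_
    · rw [Ultragraph.CKFamily.lift_s]
      ext1 φ
      exact Lp.ext ((hs e φ).trans (b.coeFn_weightedCompCLM e φ).symm)
    · rw [Ultragraph.CKFamily.lift_p]
      ext1 φ
      exact Lp.ext ((hp A φ).trans (coeFn_indicatorCLM (b.measurableSet_D A) φ).symm)
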